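/- Let $n\in\mathbb N$ and let $X,Y\in\mathbb R^{n\times n}$ be symmetric. For a real $n\times n$ matrix $A$ let $\|A\|_2=\sqrt{\operatorname{Tr}(A^\top A)}$ be its Frobenius norm and let $\|A\|_\infty=\sigma_1(A)$, the largest singular value of $A$, be its spectral norm. For a symmetric matrix $X$ let $$X_+=\operatorname*{arg\,min}_{Z\succeq 0}\|X-Z\|_2^2$$ be the (unique) projection of $X$ onto the cone of symmetric positive semidefinite $n\times n$ matrices. Then $$\|X_+-Y_+\|_2\le\|X-Y\|_2,$$ $$\|X_+-Y_+\|_\infty\le\tfrac12\left(\sqrt n+1\right)\|X-Y\|_\infty,$$ $$\|X_+-Y_+\|_\infty\le\left(\frac12+\frac2\pi+\frac1\pi\log\left(\frac{\|X\|_\infty+\|Y\|_\infty}{\|X-Y\|_\infty}\right)\right)\|X-Y\|_\infty,$$ where the right-hand side of the last inequality is read as $0$ if $X=Y$. -/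

import Mathlib

open Matrix

/-- The Frobenius norm `‖A‖₂ = √(Tr(Aᵀ A))` of a real square matrix. -/
noncomputable def frobeniusNorm {n : ℕ} (A : Matrix (Fin n) (Fin n) ℝ) : ℝ :=
  Real.sqrt (Aᵀ * A).trace

/-- The spectral norm `‖A‖_∞ = σ₁(A)` of a real square matrix: its largest singular value.
Singular values are listed in decreasing order, starting from index `0`
(and are `0` from index `n` on, so that the norm of the `0 × 0` matrix is `0`). -/
noncomputable def matrixSpectralNorm {n : ℕ} (A : Matrix (Fin n) (Fin n) ℝ) : ℝ :=
  (Matrix.toEuclideanLin A).singularValues 0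

/-- `P` is a projection of `X` onto the cone of symmetric positive semidefinite matrices:
it lies in the cone and minimises the Frobenius distance to `X` over the cone. -/
def IsPSDProjection {n : ℕ} (X P : Matrix (Fin n) (Fin n) ℝ) : Prop :=
  P.PosSemidef ∧
    ∀ Z : Matrix (Fin n) (Fin n) ℝ, Z.PosSemidef →
      frobeniusNorm (X - P) ^ 2 ≤ frobeniusNorm (X - Z) ^ 2

theorem frobeniusNorm_sq {n : ℕ} (A : Matrix (Fin n) (Fin n) ℝ) :
    frobeniusNorm A ^ 2 = ∑ i, ∑ j, A i j ^ 2 := by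
  have h : (Aᵀ * A).trace = ∑ i, ∑ j, A i j ^ 2 := by
    simp only [Matrix.trace, Matrix.diag, Matrix.mul_apply, Matrix.transpose_apply]
    rw [Finset.sum_comm]
    simp only [sq]
  rw [frobeniusNorm, Real.sq_sqrt, h]
  rw [h]
  positivity

theorem isClosed_posSemidef (n : ℕ) :
    IsClosed {Z : Matrix (Fin n) (Fin n) ℝ | Z.PosSemidef} := by
  have : {Z : Matrix (Fin n) (Fin n) ℝ | Z.PosSemidef} =
      {Z | Zᵀ = Z} ∩ ⋂ x : Fin n → ℝ, {Z | 0 ≤ x ⬝ᵥ (Z *ᵥ x)} := by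
    ext Z
    simp only [Set.mem_ofPred_eq, Set.mem_inter_iff, Set.mem_iInter,
      Matrix.posSemidef_iff_dotProduct_mulVec, Matrix.IsHermitian,
      Matrix.conjTranspose_eq_transpose_of_trivial, star_trivial]
  rw [this]
  refine (isClosed_eq (by fun_prop) (by fun_prop)).inter (isClosed_iInter fun x => ?_)
  exact isClosed_le (by fun_prop) (by fun_prop)

theorem exists_isPSDProjection {n : ℕ} (X : Matrix (Fin n) (Fin n) ℝ) :
    ∃ P, IsPSDProjection X P := by
  let S := {Z : Matrix (Fin n) (Fin n) ℝ | Z.PosSemidef}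
  let e : EuclideanSpace ℝ (Fin n × Fin n) → Matrix (Fin n) (Fin n) ℝ :=
    fun v => Matrix.of fun i j => v (i, j)
  have he : Continuous e := by
    refine continuous_matrix fun i j => ?_
    simp only [e, Matrix.of_apply]
    fun_prop
  let x : EuclideanSpace ℝ (Fin n × Fin n) := WithLp.toLp 2 fun p => X p.1 p.2
  have hd : ∀ v, dist x v ^ 2 = frobeniusNorm (X - e v) ^ 2 := by
    intro v
    rw [frobeniusNorm_sq, EuclideanSpace.dist_eq, Real.sq_sqrt (by positivity),
      Fintype.sum_prod_type]
    simp [x, e, Real.dist_eq, sq_abs]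
  have hne : (e ⁻¹' S).Nonempty := ⟨0, by
    have : e 0 = 0 := by ext i j; simp [e]
    simpa [S, this] using Matrix.PosSemidef.zero⟩
  obtain ⟨p, hp, hpx⟩ :=
    ((isClosed_posSemidef n).preimage he).exists_infDist_eq_dist hne x
  refine ⟨e p, hp, fun Z hZ => ?_⟩
  have hZe : e (WithLp.toLp 2 fun q => Z q.1 q.2) = Z := by ext i j; simp [e]
  rw [← hd, ← hZe, ← hd, ← hpx]
  have hmem : (WithLp.toLp 2 fun q => Z q.1 q.2) ∈ e ⁻¹' S := by
    rw [Set.mem_preimage, hZe]; exact hZ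
  exact pow_le_pow_left₀ Metric.infDist_nonneg (Metric.infDist_le_dist_of_mem hmem) 2

theorem IsPSDProjection.unique {n : ℕ} {X P Q : Matrix (Fin n) (Fin n) ℝ}
    (hP : IsPSDProjection X P) (hQ : IsPSDProjection X Q) : P = Q := by
  have hM : ((1 / 2 : ℝ) • (P + Q)).PosSemidef := (hP.1.add hQ.1).smul (by norm_num)
  have h1 := hP.2 _ hM
  have h2 := hQ.2 _ hM
  have key : frobeniusNorm (X - (1 / 2 : ℝ) • (P + Q)) ^ 2 =
      (1 / 2) * frobeniusNorm (X - P) ^ 2 + (1 / 2) * frobeniusNorm (X - Q) ^ 2 -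
        (1 / 4) * frobeniusNorm (P - Q) ^ 2 := by
    simp only [frobeniusNorm_sq, Finset.mul_sum, ← Finset.sum_add_distrib,
      ← Finset.sum_sub_distrib]
    refine Finset.sum_congr rfl fun i _ => Finset.sum_congr rfl fun j _ => ?_
    simp only [Matrix.sub_apply, Matrix.smul_apply, Matrix.add_apply, smul_eq_mul]
    ring
  have h0 : ∑ i, ∑ j, (P - Q) i j ^ 2 ≤ 0 := by
    rw [← frobeniusNorm_sq]; linarith
  ext i j
  have h3 : (P - Q) i j ^ 2 ≤ ∑ i, ∑ j, (P - Q) i j ^ 2 :=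
    (Finset.single_le_sum (f := fun j => (P - Q) i j ^ 2) (fun _ _ => sq_nonneg _)
      (Finset.mem_univ j)).trans
    (Finset.single_le_sum (f := fun i => ∑ j, (P - Q) i j ^ 2)
      (fun _ _ => Finset.sum_nonneg fun _ _ => sq_nonneg _) (Finset.mem_univ i))
  have h4 : (P - Q) i j = 0 := pow_eq_zero_iff (two_ne_zero) |>.1
    (le_antisymm (h3.trans h0) (sq_nonneg _))
  rw [Matrix.sub_apply] at h4
  linarith

/-- The projection `X₊ = argmin_{Z ⪰ 0} ‖X - Z‖₂²` onto the positive semidefinite cone.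
The minimiser exists by `exists_isPSDProjection` and is unique by `IsPSDProjection.unique`. -/
noncomputable def psdProj {n : ℕ} (X : Matrix (Fin n) (Fin n) ℝ) : Matrix (Fin n) (Fin n) ℝ :=
  (exists_isPSDProjection X).choose

theorem psdProj_spec {n : ℕ} (X : Matrix (Fin n) (Fin n) ℝ) : IsPSDProjection X (psdProj X) :=
  (exists_isPSDProjection X).choose_spec

/-- The largest singular value is the operator norm for the Euclidean norm. -/
theorem matrixSpectralNorm_eq_opNorm {n : ℕ} (A : Matrix (Fin n) (Fin n) ℝ) :
    matrixSpectralNorm A = ‖Matrix.toEuclideanCLM (𝕜 := ℝ) A‖ := by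
  have hfr : Module.finrank ℝ (EuclideanSpace ℝ (Fin n)) = n := by simp
  set T := Matrix.toEuclideanLin A with hT
  have hTx : ∀ x, Matrix.toEuclideanCLM (𝕜 := ℝ) A x = T x := fun x => rfl
  rcases Nat.eq_zero_or_pos n with h0 | hpos
  · subst h0
    have : Matrix.toEuclideanCLM (𝕜 := ℝ) A = 0 := by
      ext x i; exact i.elim0
    rw [this, norm_zero, matrixSpectralNorm]
    exact LinearMap.singularValues_of_finrank_le _ (by simp)
  have hS := T.isPositive_adjoint_comp_self.isSymmetric
  let b := hS.eigenvectorBasis hfr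
  have hev : ∀ i, (T.adjoint ∘ₗ T) (b i) = (T.singularValues i ^ 2) • b i := by
    intro i
    rw [LinearMap.sq_singularValues_fin T hfr i]
    exact hS.apply_eigenvectorBasis hfr i
  have hsq : ∀ x, ‖T x‖ ^ 2 = inner ℝ ((T.adjoint ∘ₗ T) x) x := by
    intro x
    rw [LinearMap.comp_apply, LinearMap.adjoint_inner_left, real_inner_self_eq_norm_sq]
  refine le_antisymm ?_ ?_
  · have h1 : ‖T (b ⟨0, hpos⟩)‖ ^ 2 = T.singularValues 0 ^ 2 := by
      rw [hsq, hev, real_inner_smul_left, real_inner_self_eq_norm_sq, b.norm_eq_one]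
      simp
    have h2 : ‖T (b ⟨0, hpos⟩)‖ = T.singularValues 0 :=
      (pow_left_inj₀ (norm_nonneg _) (T.singularValues_nonneg 0) two_ne_zero).1 h1
    have h3 := (Matrix.toEuclideanCLM (𝕜 := ℝ) A).le_opNorm (b ⟨0, hpos⟩)
    rw [hTx, h2, b.norm_eq_one, mul_one] at h3
    exact h3
  · refine ContinuousLinearMap.opNorm_le_bound _ (T.singularValues_nonneg 0) fun x => ?_
    rw [hTx]
    refine (pow_le_pow_iff_left₀ (norm_nonneg _)
      (mul_nonneg (T.singularValues_nonneg 0) (norm_nonneg _)) two_ne_zero).1 ?_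
    have hin : ∀ i, inner ℝ ((T.adjoint ∘ₗ T) x) (b i) =
        T.singularValues i ^ 2 * inner ℝ x (b i) := by
      intro i
      rw [hS x (b i), hev, real_inner_smul_right]
    rw [hsq, ← b.sum_inner_mul_inner, mul_pow, ← b.sum_sq_norm_inner_left x, Finset.mul_sum]
    refine Finset.sum_le_sum fun i _ => ?_
    rw [hin, mul_assoc]
    have hle : T.singularValues i ^ 2 ≤ T.singularValues 0 ^ 2 :=
      pow_le_pow_left₀ (T.singularValues_nonneg _) (T.singularValues_antitone (Nat.zero_le _)) 2
    have e1 : inner ℝ x (b i) * inner ℝ (b i) x = ‖inner ℝ x (b i)‖ ^ 2 := by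
      rw [real_inner_comm x (b i), Real.norm_eq_abs, sq_abs, sq]
    rw [e1]
    exact mul_le_mul_of_nonneg_right hle (sq_nonneg _)

/-! Write X = X₊ - X₋ and |X| = X₊ + X₋, where X₊X₋ = 0. Then Tr((X₊ - Y₊)(X₋ - Y₋)) = -Tr(X₊Y₋) -
Tr(Y₊X₋) ≤ 0, so neither X₊ - Y₊ nor |X| - |Y| has larger Frobenius norm than X - Y. Since X₊ - Y₊
is half of (X - Y) + (|X| - |Y|), both spectral bounds reduce to bounding |X| - |Y|. Comparing the
spectral and Frobenius norms costs the factor √n. The logarithmic bound is Kato's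
(`norm_abs_sub_abs_le`). As |a| = (2/π) ∫₀^∞ a²/(a² + t²) dt, the quadratic form of |S| - |T| at v
is 2/π times the integral of t²⟨v, ((T² + t²)⁻¹ - (S² + t²)⁻¹)v⟩. With d = ‖S - T‖ and L = ‖S‖ +
‖T‖, the integrand is at most ‖v‖² times each of 1, d/t and dL/t². Using these on [0, d], [d, L] and
[L, ∞) gives d(2 + log(L/d))‖v‖². -/

/-! ### Resolvent estimates, with p = (S² + t²)⁻¹v and q = (T² + t²)⁻¹v -/

section Resolvent

variable {E : Type*} [NormedAddCommGroup E] [InnerProductSpace ℝ E]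

theorem inner_eq_of_sq_add_smul {S : E →L[ℝ] E} (hS : S.IsSymmetric) {p v : E} {t : ℝ}
    (hp : S (S p) + t ^ 2 • p = v) : inner ℝ v p = ‖S p‖ ^ 2 + t ^ 2 * ‖p‖ ^ 2 := by
  rw [← hp, inner_add_left, real_inner_smul_left, real_inner_self_eq_norm_sq,
    ← real_inner_self_eq_norm_sq (S p)]
  congr 1
  exact hS (S p) p

theorem sq_mul_norm_le_of_sq_add_smul {S : E →L[ℝ] E} (hS : S.IsSymmetric) {p v : E} {t : ℝ}
    (hp : S (S p) + t ^ 2 • p = v) : t ^ 2 * ‖p‖ ≤ ‖v‖ := by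
  rcases (norm_nonneg p).eq_or_lt with h0 | h0
  · rw [← h0, mul_zero]; exact norm_nonneg v
  · refine le_of_mul_le_mul_right ?_ h0
    have := inner_eq_of_sq_add_smul hS hp
    nlinarith [real_inner_le_norm v p, sq_nonneg ‖S p‖]

theorem inner_nonneg_of_sq_add_smul {S : E →L[ℝ] E} (hS : S.IsSymmetric) {p v : E} {t : ℝ}
    (hp : S (S p) + t ^ 2 • p = v) : 0 ≤ inner ℝ v p := by
  rw [inner_eq_of_sq_add_smul hS hp]; positivity

theorem sq_mul_inner_le_of_sq_add_smul {S : E →L[ℝ] E} (hS : S.IsSymmetric) {p v : E} {t : ℝ}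
    (hp : S (S p) + t ^ 2 • p = v) : t ^ 2 * inner ℝ v p ≤ ‖v‖ ^ 2 := by
  calc t ^ 2 * inner ℝ v p ≤ t ^ 2 * (‖v‖ * ‖p‖) := by gcongr; exact real_inner_le_norm v p
    _ = ‖v‖ * (t ^ 2 * ‖p‖) := by ring
    _ ≤ ‖v‖ * ‖v‖ := by gcongr; exact sq_mul_norm_le_of_sq_add_smul hS hp
    _ = ‖v‖ ^ 2 := by ring

/-- Second resolvent identity, tested on v: ⟨v, q - p⟩ = ⟨p, (S² - T²)q⟩ with S² - T² = S(S - T) +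
(S - T)T. -/
theorem abs_inner_sub_inner_le {S T : E →L[ℝ] E} (hS : S.IsSymmetric) (hT : T.IsSymmetric)
    {p q v : E} {t : ℝ} (hp : S (S p) + t ^ 2 • p = v) (hq : T (T q) + t ^ 2 • q = v) :
    |inner ℝ v q - inner ℝ v p| ≤ ‖S - T‖ * (‖S p‖ * ‖q‖ + ‖p‖ * ‖T q‖) := by
  have hSpq : inner ℝ (S (S p)) q = inner ℝ (S p) (S q) := hS (S p) q
  have hTpq : inner ℝ (T (T q)) p = inner ℝ (T p) (T q) := by
    rw [real_inner_comm (T q) (T p)]; exact hT (T q) p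
  have key : inner ℝ v q - inner ℝ v p
      = inner ℝ (S p) ((S - T) q) + inner ℝ ((S - T) p) (T q) := by
    nth_rewrite 1 [← hp]
    nth_rewrite 1 [← hq]
    simp only [inner_add_left, real_inner_smul_left, _root_.sub_apply,
      inner_sub_left, inner_sub_right, hSpq, hTpq, real_inner_comm p q]
    ring
  rw [key]
  calc |inner ℝ (S p) ((S - T) q) + inner ℝ ((S - T) p) (T q)|
      ≤ ‖S p‖ * ‖(S - T) q‖ + ‖(S - T) p‖ * ‖T q‖ :=
        (abs_add_le _ _).trans (add_le_add (abs_real_inner_le_norm _ _)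
          (abs_real_inner_le_norm _ _))
    _ ≤ ‖S p‖ * (‖S - T‖ * ‖q‖) + (‖S - T‖ * ‖p‖) * ‖T q‖ := by
        gcongr <;> exact ContinuousLinearMap.le_opNorm _ _
    _ = _ := by ring

theorem sq_mul_abs_inner_sub_inner_le_div {S T : E →L[ℝ] E} (hS : S.IsSymmetric)
    (hT : T.IsSymmetric) {p q v : E} {t : ℝ} (ht : 0 < t)
    (hp : S (S p) + t ^ 2 • p = v) (hq : T (T q) + t ^ 2 • q = v) :
    t ^ 2 * |inner ℝ v q - inner ℝ v p| ≤ ‖S - T‖ * ‖v‖ ^ 2 / t := by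
  rw [le_div_iff₀ ht]
  -- AM-GM on the pairs (‖Sp‖, t‖q‖) and (‖Tq‖, t‖p‖); the four squares regroup into ⟨v, p⟩ + ⟨v,
  -- q⟩.
  have h1 : t * (‖S p‖ * ‖q‖ + ‖p‖ * ‖T q‖) ≤ (inner ℝ v p + inner ℝ v q) / 2 := by
    rw [inner_eq_of_sq_add_smul hS hp, inner_eq_of_sq_add_smul hT hq]
    nlinarith [sq_nonneg (‖S p‖ - t * ‖q‖), sq_nonneg (‖T q‖ - t * ‖p‖)]
  calc t ^ 2 * |inner ℝ v q - inner ℝ v p| * t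
      ≤ t ^ 2 * (‖S - T‖ * (‖S p‖ * ‖q‖ + ‖p‖ * ‖T q‖)) * t := by
        gcongr; exact abs_inner_sub_inner_le hS hT hp hq
    _ = ‖S - T‖ * (t ^ 2 * (t * (‖S p‖ * ‖q‖ + ‖p‖ * ‖T q‖))) := by ring
    _ ≤ ‖S - T‖ * (t ^ 2 * ((inner ℝ v p + inner ℝ v q) / 2)) := by gcongr
    _ ≤ ‖S - T‖ * ‖v‖ ^ 2 := by
        gcongr
        linarith [sq_mul_inner_le_of_sq_add_smul hS hp, sq_mul_inner_le_of_sq_add_smul hT hq]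

theorem sq_mul_abs_inner_sub_inner_le_div_sq {S T : E →L[ℝ] E} (hS : S.IsSymmetric)
    (hT : T.IsSymmetric) {p q v : E} {t : ℝ} (ht : 0 < t)
    (hp : S (S p) + t ^ 2 • p = v) (hq : T (T q) + t ^ 2 • q = v) :
    t ^ 2 * |inner ℝ v q - inner ℝ v p| ≤ ‖S - T‖ * (‖S‖ + ‖T‖) * ‖v‖ ^ 2 / t ^ 2 := by
  rw [le_div_iff₀ (by positivity)]
  calc t ^ 2 * |inner ℝ v q - inner ℝ v p| * t ^ 2
      ≤ t ^ 2 * (‖S - T‖ * ((‖S‖ * ‖p‖) * ‖q‖ + ‖p‖ * (‖T‖ * ‖q‖))) * t ^ 2 := by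
        gcongr
        refine (abs_inner_sub_inner_le hS hT hp hq).trans ?_
        gcongr <;> exact ContinuousLinearMap.le_opNorm _ _
    _ = ‖S - T‖ * (‖S‖ + ‖T‖) * ((t ^ 2 * ‖p‖) * (t ^ 2 * ‖q‖)) := by ring
    _ ≤ ‖S - T‖ * (‖S‖ + ‖T‖) * (‖v‖ * ‖v‖) := by
        gcongr
        · exact sq_mul_norm_le_of_sq_add_smul hS hp
        · exact sq_mul_norm_le_of_sq_add_smul hT hq
    _ = _ := by ring

end Resolvent

/-! ### Scalar calculus: comparing primitives -/

theorem abs_le_of_abs_deriv_le {f f' B B' : ℝ → ℝ} {a b : ℝ} (hab : a ≤ b)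
    (hf : ∀ x, HasDerivAt f (f' x) x) (hB : ContinuousOn B (Set.Icc a b))
    (hB' : ∀ x ∈ Set.Ioo a b, HasDerivAt B (B' x) x)
    (h : ∀ x ∈ Set.Ioo a b, |f' x| ≤ B' x) : |f b| ≤ |f a| + (B b - B a) := by
  have hfc : ContinuousOn f (Set.Icc a b) := fun x _ => (hf x).continuousAt.continuousWithinAt
  have h1 : f b - f a ≤ B b - B a := by
    have : MonotoneOn (fun x => B x - f x) (Set.Icc a b) := by
      refine monotoneOn_of_hasDerivWithinAt_nonneg (f' := fun x => B' x - f' x)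
        (convex_Icc a b) (hB.sub hfc) ?_ ?_ <;> rw [interior_Icc] <;> intro x hx
      · exact ((hB' x hx).sub (hf x)).hasDerivWithinAt
      · linarith [le_abs_self (f' x), h x hx]
    have := this (Set.left_mem_Icc.2 hab) (Set.right_mem_Icc.2 hab) hab
    simp only at this; linarith
  have h2 : -(f b - f a) ≤ B b - B a := by
    have : MonotoneOn (fun x => B x + f x) (Set.Icc a b) := by
      refine monotoneOn_of_hasDerivWithinAt_nonneg (f' := fun x => B' x + f' x)
        (convex_Icc a b) (hB.add hfc) ?_ ?_ <;> rw [interior_Icc] <;> intro x hx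
      · exact ((hB' x hx).add (hf x)).hasDerivWithinAt
      · linarith [neg_abs_le (f' x), h x hx]
    have := this (Set.left_mem_Icc.2 hab) (Set.right_mem_Icc.2 hab) hab
    simp only at this; linarith
  have := abs_le.2 ⟨by linarith, h1⟩
  linarith [abs_sub_abs_le_abs_sub (f b) (f a)]

/-- A truncated form of `|a| = (2 / π) ∫₀^∞ a² / (a² + t²) dt`: the derivative of
`t ↦ |a| arctan (t / |a|)`. -/
theorem hasDerivAt_abs_mul_arctan_div (a t : ℝ) :
    HasDerivAt (fun s => |a| * Real.arctan (s / |a|)) (a ^ 2 / (a ^ 2 + t ^ 2)) t := by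
  rcases eq_or_ne a 0 with rfl | ha
  · simpa using hasDerivAt_const t (0 : ℝ)
  · have h := (((hasDerivAt_id t).div_const |a|).arctan).const_mul |a|
    refine h.congr_deriv ?_
    have : 0 < |a| := abs_pos.2 ha
    rw [← sq_abs a]
    simp only [id]
    field_simp

theorem tendsto_abs_mul_arctan_div (a : ℝ) :
    Filter.Tendsto (fun s => |a| * Real.arctan (s / |a|)) Filter.atTop
      (nhds (Real.pi / 2 * |a|)) := by
  rcases eq_or_ne a 0 with rfl | ha
  · simp
  · rw [mul_comm (Real.pi / 2)]
    exact ((tendsto_nhds_of_tendsto_nhdsWithin Real.tendsto_arctan_atTop).comp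
      (Filter.tendsto_id.atTop_div_const (abs_pos.2 ha))).const_mul _

/-- The estimate of a primitive of a function bounded by `1`, `d / t` and `d L / t²`. -/
theorem abs_le_of_abs_deriv_le_min {f f' : ℝ → ℝ} {c d L R : ℝ} (hd : 0 < d) (hdL : d ≤ L)
    (hLR : L ≤ R) (hc : 0 ≤ c) (hf0 : f 0 = 0) (hf : ∀ x, HasDerivAt f (f' x) x)
    (h1 : ∀ t, 0 < t → |f' t| ≤ c) (h2 : ∀ t, 0 < t → |f' t| ≤ d * c / t)
    (h3 : ∀ t, 0 < t → |f' t| ≤ d * L * c / t ^ 2) :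
    |f R| ≤ d * (2 + Real.log (L / d)) * c := by
  have hL : 0 < L := hd.trans_le hdL
  have hR : 0 < R := hL.trans_le hLR
  -- The three ranges contribute dc, dc log(L/d) and at most dc.
  have e1 : |f d| ≤ |f 0| + (c * d - c * 0) :=
    abs_le_of_abs_deriv_le (B := fun x => c * x) (B' := fun _ => c) hd.le hf (by fun_prop)
      (fun x _ => by simpa using (hasDerivAt_id x).const_mul c) fun x hx => h1 x hx.1
  have e2 : |f L| ≤ |f d| + (d * c * Real.log L - d * c * Real.log d) := by
    refine abs_le_of_abs_deriv_le (B := fun x => d * c * Real.log x) (B' := fun x => d * c / x)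
      hdL hf ?_ (fun x hx => ?_) fun x hx => h2 x (hd.trans hx.1)
    · exact continuousOn_const.mul (Real.continuousOn_log.mono fun x hx =>
        (hd.trans_le hx.1).ne')
    · rw [div_eq_mul_inv]
      exact (Real.hasDerivAt_log (hd.trans hx.1).ne').const_mul _
  have e3 : |f R| ≤ |f L| + (-(d * L * c) * R⁻¹ - -(d * L * c) * L⁻¹) := by
    refine abs_le_of_abs_deriv_le (B := fun x => -(d * L * c) * x⁻¹)
      (B' := fun x => d * L * c / x ^ 2)
      hLR hf ?_ (fun x hx => ?_) fun x hx => h3 x (hL.trans hx.1)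
    · exact continuousOn_const.mul (continuousOn_inv₀.mono fun x hx =>
        (hL.trans_le hx.1).ne')
    · refine ((hasDerivAt_inv (hL.trans hx.1).ne').const_mul (-(d * L * c))).congr_deriv ?_
      ring
  rw [Real.log_div hL.ne' hd.ne']
  have e4 : -(d * L * c) * R⁻¹ - -(d * L * c) * L⁻¹ ≤ d * c := by
    have : d * L * c * L⁻¹ = d * c := by field_simp
    have : 0 ≤ d * L * c * R⁻¹ := by positivity
    linarith
  rw [hf0, abs_zero] at e1
  nlinarith

/-! ### Kato's estimate -/

section AbsDifference

variable {E ι κ : Type*} [NormedAddCommGroup E] [InnerProductSpace ℝ E] [Fintype ι] [Fintype κ]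

theorem OrthonormalBasis.inner_apply_self_of_eigen (b : OrthonormalBasis ι ℝ E) {S : E →L[ℝ] E}
    {w : ι → ℝ} (hS : ∀ i, S (b i) = w i • b i) (v : E) :
    inner ℝ (S v) v = ∑ i, w i * inner ℝ (b i) v ^ 2 := by
  nth_rewrite 1 [← b.sum_repr' v]
  rw [map_sum, sum_inner]
  refine Finset.sum_congr rfl fun i _ => ?_
  rw [map_smul, hS, smul_smul, real_inner_smul_left]
  ring

/-- Here p is (S² + t²)⁻¹v written in the eigenbasis, and w²/(w² + t²) = 1 - t²/(w² + t²). -/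
theorem OrthonormalBasis.sum_eigen_div_mul_inner_sq (b : OrthonormalBasis ι ℝ E)
    {S : E →L[ℝ] E} {w : ι → ℝ} (hS : ∀ i, S (b i) = w i • b i) (v : E) {t : ℝ} (ht : 0 < t) :
    ∃ p, S (S p) + t ^ 2 • p = v ∧
      ∑ i, w i ^ 2 / (w i ^ 2 + t ^ 2) * inner ℝ (b i) v ^ 2 =
        ‖v‖ ^ 2 - t ^ 2 * inner ℝ v p := by
  have hne : ∀ i, w i ^ 2 + t ^ 2 ≠ 0 := fun i => by positivity
  refine ⟨∑ i, (inner ℝ (b i) v / (w i ^ 2 + t ^ 2)) • b i, ?_, ?_⟩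
  · nth_rewrite 3 [← b.sum_repr' v]
    simp only [map_sum, map_smul, hS, Finset.smul_sum, ← Finset.sum_add_distrib, smul_smul,
      ← add_smul]
    refine Finset.sum_congr rfl fun i _ => ?_
    congr 1
    have := hne i
    field_simp
  · rw [inner_sum, Finset.mul_sum, ← b.sum_sq_norm_inner_right v, ← Finset.sum_sub_distrib]
    refine Finset.sum_congr rfl fun i _ => ?_
    rw [real_inner_smul_right, real_inner_comm, Real.norm_eq_abs, sq_abs]
    have := hne i
    field_simp
    ring

/-- Kato's estimate for the difference of the absolute values of two symmetric operators. -/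
theorem norm_abs_sub_abs_le [CompleteSpace E] (b : OrthonormalBasis ι ℝ E)
    (c : OrthonormalBasis κ ℝ E)
    {S T A B : E →L[ℝ] E} {w : ι → ℝ} {u : κ → ℝ} (hS : S.IsSymmetric) (hT : T.IsSymmetric)
    (hAB : (A - B).IsSymmetric) (hSb : ∀ i, S (b i) = w i • b i) (hTc : ∀ i, T (c i) = u i • c i)
    (hAb : ∀ i, A (b i) = |w i| • b i) (hBc : ∀ i, B (c i) = |u i| • c i) (hST : S ≠ T) :
    ‖A - B‖ ≤ 2 / Real.pi * (‖S - T‖ * (2 + Real.log ((‖S‖ + ‖T‖) / ‖S - T‖))) := by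
  set d := ‖S - T‖ with hd_def
  set L := ‖S‖ + ‖T‖ with hL_def
  have hd : 0 < d := norm_pos_iff.2 (sub_ne_zero.2 hST)
  have hdL : d ≤ L := norm_sub_le S T
  have hlog : 0 ≤ Real.log (L / d) := Real.log_nonneg ((one_le_div hd).2 hdL)
  have hM : 0 ≤ 2 / Real.pi * (d * (2 + Real.log (L / d))) := by positivity
  have quad : ∀ v, |inner ℝ ((A - B) v) v| ≤
      2 / Real.pi * (d * (2 + Real.log (L / d))) * ‖v‖ ^ 2 := by
    intro v
    -- `F` is the integral truncated at t and `F'` its integrand.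
    let F : ℝ → ℝ := fun t =>
      (∑ i, |w i| * Real.arctan (t / |w i|) * inner ℝ (b i) v ^ 2) -
        ∑ i, |u i| * Real.arctan (t / |u i|) * inner ℝ (c i) v ^ 2
    let F' : ℝ → ℝ := fun t =>
      (∑ i, w i ^ 2 / (w i ^ 2 + t ^ 2) * inner ℝ (b i) v ^ 2) -
        ∑ i, u i ^ 2 / (u i ^ 2 + t ^ 2) * inner ℝ (c i) v ^ 2
    have hF : ∀ t, HasDerivAt F (F' t) t := fun t =>
      (HasDerivAt.fun_sum fun i _ => (hasDerivAt_abs_mul_arctan_div (w i) t).mul_const _).sub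
        (HasDerivAt.fun_sum fun i _ => (hasDerivAt_abs_mul_arctan_div (u i) t).mul_const _)
    have hF' : ∀ t, 0 < t → ∃ p q, S (S p) + t ^ 2 • p = v ∧ T (T q) + t ^ 2 • q = v ∧
        F' t = t ^ 2 * (inner ℝ v q - inner ℝ v p) := by
      intro t ht
      obtain ⟨p, hp, hp'⟩ := b.sum_eigen_div_mul_inner_sq hSb v ht
      obtain ⟨q, hq, hq'⟩ := c.sum_eigen_div_mul_inner_sq hTc v ht
      refine ⟨p, q, hp, hq, ?_⟩
      simp only [F', hp', hq']
      ring
    have hlim : Filter.Tendsto F Filter.atTop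
        (nhds (Real.pi / 2 * inner ℝ ((A - B) v) v)) := by
      have : Real.pi / 2 * inner ℝ ((A - B) v) v =
          (∑ i, Real.pi / 2 * |w i| * inner ℝ (b i) v ^ 2) -
            ∑ i, Real.pi / 2 * |u i| * inner ℝ (c i) v ^ 2 := by
        rw [_root_.sub_apply, inner_sub_left, b.inner_apply_self_of_eigen hAb,
          c.inner_apply_self_of_eigen hBc, mul_sub, Finset.mul_sum, Finset.mul_sum]
        simp only [mul_assoc]
      rw [this]
      exact (tendsto_finsetSum _ fun i _ => (tendsto_abs_mul_arctan_div (w i)).mul_const _).sub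
        (tendsto_finsetSum _ fun i _ => (tendsto_abs_mul_arctan_div (u i)).mul_const _)
    have hbound : ∀ R, L ≤ R → |F R| ≤ d * (2 + Real.log (L / d)) * ‖v‖ ^ 2 := by
      intro R hR
      refine abs_le_of_abs_deriv_le_min hd hdL hR (by positivity) (by simp [F]) hF
        (fun t ht => ?_) (fun t ht => ?_) fun t ht => ?_ <;>
        obtain ⟨p, q, hp, hq, h⟩ := hF' t ht <;> rw [h]
      -- Both terms of the difference lie in [0, ‖v‖²], so no factor 2 is lost.
      · rw [abs_le]
        have h1 := sq_mul_inner_le_of_sq_add_smul hS hp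
        have h2 := sq_mul_inner_le_of_sq_add_smul hT hq
        have h3 := mul_nonneg (sq_nonneg t) (inner_nonneg_of_sq_add_smul hS hp)
        have h4 := mul_nonneg (sq_nonneg t) (inner_nonneg_of_sq_add_smul hT hq)
        rw [mul_sub]
        constructor <;> linarith
      · rw [abs_mul, abs_of_nonneg (sq_nonneg t)]
        exact sq_mul_abs_inner_sub_inner_le_div hS hT ht hp hq
      · rw [abs_mul, abs_of_nonneg (sq_nonneg t)]
        exact sq_mul_abs_inner_sub_inner_le_div_sq hS hT ht hp hq
    -- The bound does not depend on R, so it survives R → ∞.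
    have hle := le_of_tendsto hlim.abs (Filter.eventually_atTop.2 ⟨L, hbound⟩)
    rw [abs_mul, abs_of_pos (by positivity)] at hle
    have hπ := Real.pi_pos
    calc |inner ℝ ((A - B) v) v| = 2 / Real.pi * (Real.pi / 2 * |inner ℝ ((A - B) v) v|) := by
          field_simp
      _ ≤ 2 / Real.pi * (d * (2 + Real.log (L / d)) * ‖v‖ ^ 2) := by gcongr
      _ = _ := by ring
  rw [(A - B).norm_eq_iSup_rayleighQuotient hAB]
  refine ciSup_le fun v => ?_
  rw [ContinuousLinearMap.rayleighQuotient, abs_div, abs_of_nonneg (sq_nonneg ‖v‖)]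
  refine div_le_of_le_mul₀ (sq_nonneg _) hM ?_
  exact quad v

end AbsDifference

/-! ### Spectral calculus in a fixed eigenbasis -/

namespace Matrix

open scoped MatrixOrder in
-- With B = CᵀC, cyclicity turns the trace into that of CACᵀ.
theorem PosSemidef.trace_mul_nonneg {ι : Type*} [Fintype ι] {A B : Matrix ι ι ℝ}
    (hA : A.PosSemidef) (hB : B.PosSemidef) : 0 ≤ (A * B).trace := by
  classical
  obtain ⟨C, rfl⟩ := CStarAlgebra.nonneg_iff_eq_star_mul_self.1 hB.nonneg
  rw [← Matrix.mul_assoc, trace_mul_comm, ← Matrix.mul_assoc]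
  exact (hA.mul_mul_conjTranspose_same C).trace_nonneg

/-- The matrix with the eigenvectors of `X` and with the eigenvalues replaced by `w`. -/
noncomputable def IsHermitian.withEigenvalues {ι : Type*} [Fintype ι] [DecidableEq ι]
    {X : Matrix ι ι ℝ} (hX : X.IsHermitian) (w : ι → ℝ) : Matrix ι ι ℝ :=
  (hX.eigenvectorUnitary : Matrix ι ι ℝ) * diagonal w * star (hX.eigenvectorUnitary : Matrix ι ι ℝ)

section WithEigenvalues

variable {ι : Type*} [Fintype ι] [DecidableEq ι] {X : Matrix ι ι ℝ} (hX : X.IsHermitian)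

theorem IsHermitian.withEigenvalues_eigenvalues : hX.withEigenvalues hX.eigenvalues = X :=
  hX.spectral_theorem.symm

theorem IsHermitian.withEigenvalues_sub (w u : ι → ℝ) :
    hX.withEigenvalues (w - u) = hX.withEigenvalues w - hX.withEigenvalues u := by
  have h : diagonal (w - u) = diagonal w - diagonal u := (diagonal_sub w u).symm
  rw [withEigenvalues, h, Matrix.mul_sub, Matrix.sub_mul]
  rfl

theorem IsHermitian.withEigenvalues_mul (w u : ι → ℝ) :
    hX.withEigenvalues w * hX.withEigenvalues u = hX.withEigenvalues (w * u) := by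
  have h : star (hX.eigenvectorUnitary : Matrix ι ι ℝ) * (hX.eigenvectorUnitary : Matrix ι ι ℝ)
      = 1 := Unitary.coe_star_mul_self _
  calc _ = (hX.eigenvectorUnitary : Matrix ι ι ℝ) * diagonal w *
        (star (hX.eigenvectorUnitary : Matrix ι ι ℝ) * (hX.eigenvectorUnitary : Matrix ι ι ℝ)) *
        diagonal u * star (hX.eigenvectorUnitary : Matrix ι ι ℝ) := by
          simp only [withEigenvalues, Matrix.mul_assoc]
    _ = _ := by
          rw [h, Matrix.mul_one, Matrix.mul_assoc _ (diagonal w), diagonal_mul_diagonal]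
          rfl

theorem IsHermitian.withEigenvalues_zero : hX.withEigenvalues 0 = 0 := by
  have : diagonal (0 : ι → ℝ) = 0 := diagonal_zero
  rw [withEigenvalues, this, Matrix.mul_zero, Matrix.zero_mul]

theorem IsHermitian.posSemidef_withEigenvalues {w : ι → ℝ} (hw : ∀ i, 0 ≤ w i) :
    (hX.withEigenvalues w).PosSemidef :=
  (posSemidef_diagonal_iff.2 hw).mul_mul_conjTranspose_same _

theorem IsHermitian.withEigenvalues_mulVec (w : ι → ℝ) (i : ι) :
    hX.withEigenvalues w *ᵥ (hX.eigenvectorBasis i).ofLp = w i • (hX.eigenvectorBasis i).ofLp := by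
  rw [withEigenvalues, ← mulVec_mulVec, ← mulVec_mulVec, hX.star_eigenvectorUnitary_mulVec,
    diagonal_mulVec_single, mul_one, ← hX.eigenvectorUnitary_mulVec, ← mulVec_smul,
    ← Pi.single_smul, smul_eq_mul, mul_one]

theorem IsHermitian.toEuclideanCLM_eigenvectorBasis (i : ι) :
    toEuclideanCLM (𝕜 := ℝ) X (hX.eigenvectorBasis i)
      = hX.eigenvalues i • hX.eigenvectorBasis i := by
  ext j
  exact congrFun (hX.mulVec_eigenvectorBasis i) j

theorem IsHermitian.isSymmetric_toEuclideanCLM {Z : Matrix ι ι ℝ} (hZ : Z.IsHermitian) :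
    (toEuclideanCLM (𝕜 := ℝ) Z).IsSymmetric :=
  isSymmetric_toEuclideanLin_iff.2 hZ

end WithEigenvalues

end Matrix

/-! ### Frobenius norm: trace identities and comparison with the spectral norm -/

section FrobeniusNorm

variable {n : ℕ}

theorem frobeniusNorm_nonneg (A : Matrix (Fin n) (Fin n) ℝ) : 0 ≤ frobeniusNorm A :=
  Real.sqrt_nonneg _

theorem Matrix.IsHermitian.frobeniusNorm_sq_eq_trace {A : Matrix (Fin n) (Fin n) ℝ}
    (hA : A.IsHermitian) : frobeniusNorm A ^ 2 = (A * A).trace := by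
  have h : Aᵀ = A := hA
  rw [frobeniusNorm, Real.sq_sqrt, h]
  exact (posSemidef_conjTranspose_mul_self A).trace_nonneg

theorem Matrix.IsHermitian.frobeniusNorm_sub_sq {A B : Matrix (Fin n) (Fin n) ℝ}
    (hA : A.IsHermitian) (hB : B.IsHermitian) :
    frobeniusNorm (A - B) ^ 2
      = frobeniusNorm A ^ 2 + frobeniusNorm B ^ 2 - 2 * (A * B).trace := by
  rw [(hA.sub hB).frobeniusNorm_sq_eq_trace, hA.frobeniusNorm_sq_eq_trace,
    hB.frobeniusNorm_sq_eq_trace]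
  simp only [mul_sub, sub_mul, trace_sub, trace_mul_comm B A]
  ring

theorem Matrix.IsHermitian.frobeniusNorm_add_sq {A B : Matrix (Fin n) (Fin n) ℝ}
    (hA : A.IsHermitian) (hB : B.IsHermitian) :
    frobeniusNorm (A + B) ^ 2
      = frobeniusNorm A ^ 2 + frobeniusNorm B ^ 2 + 2 * (A * B).trace := by
  rw [(hA.add hB).frobeniusNorm_sq_eq_trace, hA.frobeniusNorm_sq_eq_trace,
    hB.frobeniusNorm_sq_eq_trace]
  simp only [mul_add, add_mul, trace_add, trace_mul_comm B A]
  ring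

theorem frobeniusNorm_sq_eq_sum_norm_sq (A : Matrix (Fin n) (Fin n) ℝ) :
    frobeniusNorm A ^ 2
      = ∑ j, ‖toEuclideanCLM (𝕜 := ℝ) A (EuclideanSpace.single j 1)‖ ^ 2 := by
  rw [frobeniusNorm_sq, Finset.sum_comm]
  refine Finset.sum_congr rfl fun j _ => ?_
  rw [EuclideanSpace.real_norm_sq_eq]
  simp [ofLp_toEuclideanCLM]

theorem frobeniusNorm_le_sqrt_mul (A : Matrix (Fin n) (Fin n) ℝ) :
    frobeniusNorm A ≤ Real.sqrt n * matrixSpectralNorm A := by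
  rw [matrixSpectralNorm_eq_opNorm]
  refine le_of_sq_le_sq ?_ (by positivity)
  rw [mul_pow, Real.sq_sqrt (Nat.cast_nonneg n), frobeniusNorm_sq_eq_sum_norm_sq]
  calc ∑ j, ‖toEuclideanCLM (𝕜 := ℝ) A (EuclideanSpace.single j 1)‖ ^ 2
      ≤ ∑ _j : Fin n, ‖toEuclideanCLM (𝕜 := ℝ) A‖ ^ 2 := by
        refine Finset.sum_le_sum fun j _ => pow_le_pow_left₀ (norm_nonneg _) ?_ 2
        simpa using (toEuclideanCLM (𝕜 := ℝ) A).le_opNorm (EuclideanSpace.single j 1)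
    _ = _ := by simp

theorem matrixSpectralNorm_le_frobeniusNorm (A : Matrix (Fin n) (Fin n) ℝ) :
    matrixSpectralNorm A ≤ frobeniusNorm A := by
  rw [matrixSpectralNorm_eq_opNorm]
  refine ContinuousLinearMap.opNorm_le_bound _ (frobeniusNorm_nonneg A) fun x => ?_
  refine le_of_sq_le_sq ?_ (mul_nonneg (frobeniusNorm_nonneg A) (norm_nonneg x))
  rw [mul_pow, frobeniusNorm_sq, EuclideanSpace.real_norm_sq_eq, EuclideanSpace.real_norm_sq_eq,
    Finset.sum_mul]
  refine Finset.sum_le_sum fun i _ => ?_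
  rw [ofLp_toEuclideanCLM]
  -- Cauchy–Schwarz in each row.
  exact Finset.sum_mul_sq_le_sq_mul_sq Finset.univ (A i) x.ofLp

end FrobeniusNorm

/-! ### The projection as positive part, and the resulting bounds -/

section Projection

variable {n : ℕ} {X Y : Matrix (Fin n) (Fin n) ℝ}

/-- Complementary slackness: as Tr(PN) = 0, ‖P - N - Z‖² = ‖P - Z‖² + ‖N‖² + 2 Tr(ZN) ≥ ‖N‖². -/
theorem isPSDProjection_of_mul_eq_zero {P N : Matrix (Fin n) (Fin n) ℝ} (hP : P.PosSemidef)
    (hN : N.PosSemidef) (h : N * P = 0) : IsPSDProjection (P - N) P := by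
  refine ⟨hP, fun Z hZ => ?_⟩
  have e1 : P - N - P = -N := by abel
  have e2 : P - N - Z = (P - Z) - N := by abel
  have h0 : frobeniusNorm (-N) = frobeniusNorm N := by simp [frobeniusNorm]
  have h1 : ((P - Z) * N).trace = - (Z * N).trace := by
    rw [Matrix.sub_mul, trace_sub, trace_mul_comm P N, h]
    simp
  rw [e1, e2, h0, (hP.1.sub hZ.1).frobeniusNorm_sub_sq hN.1, h1]
  linarith [sq_nonneg (frobeniusNorm (P - Z)), hZ.trace_mul_nonneg hN]

theorem psdProj_eq_withEigenvalues (hX : X.IsHermitian) :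
    psdProj X = hX.withEigenvalues (hX.eigenvalues ⊔ 0) := by
  have key := isPSDProjection_of_mul_eq_zero
    (hX.posSemidef_withEigenvalues (w := hX.eigenvalues ⊔ 0) fun i => le_max_right _ _)
    (hX.posSemidef_withEigenvalues (w := (-hX.eigenvalues) ⊔ 0) fun i => le_max_right _ _) (by
      rw [hX.withEigenvalues_mul, ← hX.withEigenvalues_zero]
      congr 1
      ext i
      rcases le_total (hX.eigenvalues i) 0 with h | h <;> simp [h])
  rw [← hX.withEigenvalues_sub, show hX.eigenvalues ⊔ 0 - (-hX.eigenvalues) ⊔ 0 = hX.eigenvalues by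
    ext i
    rcases le_total (hX.eigenvalues i) 0 with h | h <;> simp [h],
    hX.withEigenvalues_eigenvalues] at key
  exact (psdProj_spec X).unique key

theorem psdProj_sub_self_eq_withEigenvalues (hX : X.IsHermitian) :
    psdProj X - X = hX.withEigenvalues ((-hX.eigenvalues) ⊔ 0) := by
  nth_rewrite 2 [← hX.withEigenvalues_eigenvalues]
  rw [psdProj_eq_withEigenvalues hX, ← hX.withEigenvalues_sub]
  congr 1
  ext i
  rcases le_total (hX.eigenvalues i) 0 with h | h <;> simp [h]

theorem posSemidef_psdProj (X : Matrix (Fin n) (Fin n) ℝ) : (psdProj X).PosSemidef :=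
  (psdProj_spec X).1

theorem posSemidef_psdProj_sub_self (hX : X.IsHermitian) : (psdProj X - X).PosSemidef := by
  rw [psdProj_sub_self_eq_withEigenvalues hX]
  exact hX.posSemidef_withEigenvalues fun i => le_max_right _ _

theorem psdProj_mul_psdProj_sub_self (hX : X.IsHermitian) :
    psdProj X * (psdProj X - X) = 0 := by
  rw [psdProj_sub_self_eq_withEigenvalues hX, psdProj_eq_withEigenvalues hX,
    hX.withEigenvalues_mul, ← hX.withEigenvalues_zero]
  congr 1
  ext i
  rcases le_total (hX.eigenvalues i) 0 with h | h <;> simp [h]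

/-- The absolute value `X₊ + X₋` of a symmetric matrix acts on the eigenvectors of `X` through
the absolute values of the eigenvalues. -/
theorem toEuclideanCLM_abs_eigenvectorBasis (hX : X.IsHermitian) (i : Fin n) :
    toEuclideanCLM (𝕜 := ℝ) (psdProj X + (psdProj X - X)) (hX.eigenvectorBasis i)
      = |hX.eigenvalues i| • hX.eigenvectorBasis i := by
  ext j
  rw [ofLp_toEuclideanCLM, add_mulVec, psdProj_sub_self_eq_withEigenvalues hX,
    psdProj_eq_withEigenvalues hX, hX.withEigenvalues_mulVec, hX.withEigenvalues_mulVec, ← add_smul]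
  rcases le_total (hX.eigenvalues i) 0 with h | h <;> simp [h, abs_of_nonpos, abs_of_nonneg]

/-- The products X₊X₋ and Y₊Y₋ vanish, leaving -Tr(X₊Y₋) - Tr(Y₊X₋). -/
theorem trace_psdProj_sub_mul_nonpos (hX : X.IsHermitian) (hY : Y.IsHermitian) :
    ((psdProj X - psdProj Y) * ((psdProj X - X) - (psdProj Y - Y))).trace ≤ 0 := by
  rw [Matrix.sub_mul, Matrix.mul_sub _ (_ - _), Matrix.mul_sub _ (_ - _), psdProj_mul_psdProj_sub_self hX,
    psdProj_mul_psdProj_sub_self hY]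
  have h1 := (posSemidef_psdProj X).trace_mul_nonneg (posSemidef_psdProj_sub_self hY)
  have h2 := (posSemidef_psdProj Y).trace_mul_nonneg (posSemidef_psdProj_sub_self hX)
  simp only [trace_sub, trace_zero]
  linarith

theorem frobeniusNorm_sub_sq_eq (hX : X.IsHermitian) (hY : Y.IsHermitian) :
    frobeniusNorm (X - Y) ^ 2 = frobeniusNorm (psdProj X - psdProj Y) ^ 2 +
      frobeniusNorm ((psdProj X - X) - (psdProj Y - Y)) ^ 2 -
      2 * ((psdProj X - psdProj Y) * ((psdProj X - X) - (psdProj Y - Y))).trace := by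
  have hP := (posSemidef_psdProj X).1
  have hQ := (posSemidef_psdProj Y).1
  rw [← (hP.sub hQ).frobeniusNorm_sub_sq ((hP.sub hX).sub (hQ.sub hY))]
  congr 2
  abel

theorem frobeniusNorm_psdProj_sub_le (hX : X.IsHermitian) (hY : Y.IsHermitian) :
    frobeniusNorm (psdProj X - psdProj Y) ≤ frobeniusNorm (X - Y) := by
  refine le_of_sq_le_sq ?_ (frobeniusNorm_nonneg _)
  rw [frobeniusNorm_sub_sq_eq hX hY]
  linarith [trace_psdProj_sub_mul_nonpos hX hY,
    sq_nonneg (frobeniusNorm ((psdProj X - X) - (psdProj Y - Y)))]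

/-- The two sides are the norms of the sum and the difference of X₊ - Y₊ and X₋ - Y₋; a nonpositive
cross term makes the sum the smaller. -/
theorem frobeniusNorm_abs_sub_abs_le (hX : X.IsHermitian) (hY : Y.IsHermitian) :
    frobeniusNorm ((psdProj X + (psdProj X - X)) - (psdProj Y + (psdProj Y - Y)))
      ≤ frobeniusNorm (X - Y) := by
  have hP := (posSemidef_psdProj X).1
  have hQ := (posSemidef_psdProj Y).1
  refine le_of_sq_le_sq ?_ (frobeniusNorm_nonneg _)
  rw [frobeniusNorm_sub_sq_eq hX hY, add_sub_add_comm,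
    (hP.sub hQ).frobeniusNorm_add_sq ((hP.sub hX).sub (hQ.sub hY))]
  linarith [trace_psdProj_sub_mul_nonpos hX hY]

theorem matrixSpectralNorm_psdProj_sub_le (X Y : Matrix (Fin n) (Fin n) ℝ) :
    matrixSpectralNorm (psdProj X - psdProj Y) ≤ (1 / 2) * (matrixSpectralNorm (X - Y) +
      matrixSpectralNorm ((psdProj X + (psdProj X - X)) - (psdProj Y + (psdProj Y - Y)))) := by
  have h : psdProj X - psdProj Y = (1 / 2 : ℝ) • ((X - Y) +
      ((psdProj X + (psdProj X - X)) - (psdProj Y + (psdProj Y - Y)))) := by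
    ext i j
    simp only [Matrix.sub_apply, Matrix.smul_apply, Matrix.add_apply, smul_eq_mul]
    ring
  rw [h]
  simp only [matrixSpectralNorm_eq_opNorm]
  rw [map_smul, map_add, norm_smul, Real.norm_of_nonneg (by norm_num)]
  gcongr
  exact norm_add_le _ _

theorem matrixSpectralNorm_abs_sub_abs_le (hX : X.IsHermitian) (hY : Y.IsHermitian)
    (hXY : X ≠ Y) :
    matrixSpectralNorm ((psdProj X + (psdProj X - X)) - (psdProj Y + (psdProj Y - Y))) ≤
      2 / Real.pi * (matrixSpectralNorm (X - Y) * (2 +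
        Real.log ((matrixSpectralNorm X + matrixSpectralNorm Y) / matrixSpectralNorm (X - Y)))) := by
  have hP := (posSemidef_psdProj X).1
  have hQ := (posSemidef_psdProj Y).1
  simp only [matrixSpectralNorm_eq_opNorm]
  rw [map_sub, map_sub _ X Y]
  refine norm_abs_sub_abs_le hX.eigenvectorBasis hY.eigenvectorBasis
    hX.isSymmetric_toEuclideanCLM hY.isSymmetric_toEuclideanCLM ?_
    hX.toEuclideanCLM_eigenvectorBasis hY.toEuclideanCLM_eigenvectorBasis
    (toEuclideanCLM_abs_eigenvectorBasis hX) (toEuclideanCLM_abs_eigenvectorBasis hY)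
    ((toEuclideanCLM (𝕜 := ℝ) (n := Fin n)).injective.ne hXY)
  rw [← map_sub]
  exact ((hP.add (hP.sub hX)).sub (hQ.add (hQ.sub hY))).isSymmetric_toEuclideanCLM

end Projection

theorem mainTheorem1 (n : ℕ) (X Y : Matrix (Fin n) (Fin n) ℝ) (hX : X.IsSymm) (hY : Y.IsSymm) :
    frobeniusNorm (psdProj X - psdProj Y) ≤ frobeniusNorm (X - Y) ∧
    matrixSpectralNorm (psdProj X - psdProj Y) ≤
      (1 / 2) * (Real.sqrt (n : ℝ) + 1) * matrixSpectralNorm (X - Y) ∧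
    matrixSpectralNorm (psdProj X - psdProj Y) ≤
      (1 / 2 + 2 / Real.pi + (1 / Real.pi) *
        Real.log ((matrixSpectralNorm X + matrixSpectralNorm Y) / matrixSpectralNorm (X - Y))) *
        matrixSpectralNorm (X - Y) := by
  have hX' : X.IsHermitian := hX
  have hY' : Y.IsHermitian := hY
  have half := matrixSpectralNorm_psdProj_sub_le X Y
  refine ⟨frobeniusNorm_psdProj_sub_le hX' hY', ?_, ?_⟩
  · have h := (matrixSpectralNorm_le_frobeniusNorm _).trans
      ((frobeniusNorm_abs_sub_abs_le hX' hY').trans (frobeniusNorm_le_sqrt_mul (X - Y)))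
    linarith
  · rcases eq_or_ne X Y with rfl | hXY
    -- The factor ‖X - Y‖ = 0 annihilates the right side, whatever value the logarithm of a quotient
    -- by 0 takes.
    · simp [matrixSpectralNorm_eq_opNorm]
    · have h := matrixSpectralNorm_abs_sub_abs_le hX' hY' hXY
      refine half.trans ((mul_le_mul_of_nonneg_left (add_le_add_right h _)
        (by norm_num)).trans_eq ?_)
      ring
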